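/- Let $d\ge 0$ and let $s,\sigma:[0,1]\to\mathbb R$ be continuous with $s_0=1$, $s_t>0$ for all $t$, $\sigma_0=0$ and $\sigma_t>0$ for $t\in(0,1]$. Let $x_0$ be a random vector in $\mathbb R^d$ and, for $t\in[0,1]$, let $$x_t=s_t x_0+\sigma_t\varepsilon_t ,$$ where, for each $t\in(0,1]$, $\varepsilon_t\sim\mathcal N(0,I)$ is independent of $x_0$. (No assumption is made on the joint law of the $\varepsilon_t$ for different $t$; the case $\varepsilon_t=\varepsilon$ is allowed.) Suppose that for every $t\in[0,1]$ the vector $x_t$ has a probability density $p_t$ on $\mathbb R^d$, that $p_t$ is $C^\infty$ for each $t\in[0,1]$, and that $t\mapsto p_t(x)$ is $C^\infty$ on $[0,1]$ for each $x\in\mathbb R^d$. For $t\in(0,1]$ and $y\in\mathbb R^d$ let $\pi_{t,y}$ be the conditional law of $x_0$ given $x_t=y$ in the version given by Bayes' rule, i.e. the probability measure with $$\pi_{t,y}(dz)\ \propto\ p_0(z)\,\exp\!\Big(-\frac{\|y-s_tz\|^2}{2\sigma_t^2}\Big)\,dz .$$ Let $\hat x_0=\hat x_0(t,y)$ and $\hat\Sigma=\hat\Sigma(t,y)$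 be the mean and the covariance matrix of $\pi_{t,y}$. Then the following hold. 1. For every $t\in(0,1]$, $y\mapsto\pi_{t,y}$ agrees, for almost every $y$ with respect to the law of $x_t$, with the regular conditional distribution of $x_0$ given $x_t=y$. 2. For every $t\in(0,1]$ and every $y$, $\pi_{t,y}$ has finite second moments and $\hat\Sigma(t,y)$ is positive definite, so that $\hat\Sigma^{-1/2}$ is defined. 3. For $t\in(0,1]$, the limits $t\to0$ and $\sigma_t\to0$ are equivalent (they define the same filter). 4. Whenever $y_t\to y_0$ as $t\to0^+$ and $p_0(y_0)>0$ (in particular for a constant $y_t=y_0$), the law of $\hat\Sigma^{-1/2}(x_0-\hat x_0)$ conditioned on $x_t=y_t$, i.e. the law of $\hat\Sigma(t,y_t)^{-1/2}\big(z-\hat x_0(t,y_t)\big)$ for $z\sim\pi_{t,y_t}$, converges weakly to $\mathcal N(0,I)$ as $t\to0^+$. 5. For almost every outcome $\omega$: if $x_t(\omega)\to x_0(\omega)$ as $t\to0^+$ (which is automatic when $\varepsilon_t$ does not depend on $t$, and whenever the sample path is right-continuous at $0$), then the convergence in 4 holds with $y_t=x_t(\omega)$. -/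

import Mathlib

open MeasureTheory ProbabilityTheory Filter Set
open scoped Topology ENNReal ContDiff MatrixOrder

namespace Diffusion

variable {d : ℕ}

/-- The conditional law of `x₀` given `s • x₀ + σ • ε = y`, where `x₀` has law `μ₀` and `ε` is a
standard Gaussian vector independent of `x₀`, given by Bayes' rule: its density with respect to
`μ₀` is proportional to the Gaussian likelihood `z ↦ exp (-‖y - s z‖² / (2 σ²))` (the normalising
constant of the Gaussian density does not depend on `z` and cancels). -/
noncomputable def posterior (μ₀ : Measure (EuclideanSpace ℝ (Fin d))) (s σ : ℝ)
    (y : EuclideanSpace ℝ (Fin d)) : Measure (EuclideanSpace ℝ (Fin d)) :=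
  μ₀.tilted (fun z => -‖y - s • z‖ ^ 2 / (2 * σ ^ 2))

instance isProbabilityMeasure_posterior (μ₀ : Measure (EuclideanSpace ℝ (Fin d)))
    [IsProbabilityMeasure μ₀] (s σ : ℝ) (y : EuclideanSpace ℝ (Fin d)) :
    IsProbabilityMeasure (posterior μ₀ s σ y) := by
  refine isProbabilityMeasure_tilted (Integrable.of_bound (C := 1) ?_ (ae_of_all _ fun z => ?_))
  · exact (by fun_prop : Measurable fun z : EuclideanSpace ℝ (Fin d) =>
      Real.exp (-‖y - s • z‖ ^ 2 / (2 * σ ^ 2))).aestronglyMeasurable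
  · rw [Real.norm_eq_abs, Real.abs_exp, Real.exp_le_one_iff]
    exact div_nonpos_of_nonpos_of_nonneg (by simp) (by positivity)

/-- The mean vector of a measure. -/
noncomputable def meanVec (ν : Measure (EuclideanSpace ℝ (Fin d))) : EuclideanSpace ℝ (Fin d) :=
  ∫ z, z ∂ν

/-- The covariance matrix of a measure. -/
noncomputable def covMat (ν : Measure (EuclideanSpace ℝ (Fin d))) : Matrix (Fin d) (Fin d) ℝ :=
  Matrix.of fun i j => cov[fun z => z i, fun z => z j; ν]

/-- The standardisation map `z ↦ Σ^{-1/2} (z - m)`, where `m` and `Σ` are the mean and the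
covariance matrix of `ν`, and `Σ^{-1/2}` is the inverse of the positive semidefinite square
root. -/
noncomputable def standardize (ν : Measure (EuclideanSpace ℝ (Fin d)))
    (z : EuclideanSpace ℝ (Fin d)) : EuclideanSpace ℝ (Fin d) :=
  Matrix.toEuclideanLin (CFC.sqrt (covMat ν))⁻¹ (z - meanVec ν)

end Diffusion

/-!
The posterior of `x₀` given `X t = y` is the prior `p 0 (z) dz` weighted by a Gaussian in `z`
centred at `y / s` with standard deviation `σ / s`. In the coordinate `u = (s z - y) / σ` its
density is proportional to `p (s⁻¹ y + (σ / s) u) exp (-‖u‖² / 2)` (`integral_posterior`). As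
`σ → 0`, `s → 1` and `y → y₀`, the first factor becomes the positive constant `p y₀`, so the law
of `u` becomes standard Gaussian. The density `p` may be unbounded far from `y₀`, but there the
Gaussian factor is smaller than any power of `σ`, while `p` is integrable
(`tendsto_integral_mul_comp_add_smul`).

This convergence holds for test functions of quadratic growth which may vary along the limit
(`tendsto_integral_posterior`). The quadratic growth gives convergence of the mean of `u` to `0`
and of its covariance to the identity, so that the standardisation map of the law of `u` tends
pointwise to the identity (`tendsto_standardize`). Composing a bounded continuous function with
these varying maps gives weak convergence of the standardised law, and standardisation does not
depend on whether the coordinate `z` or `u` is used (`standardize_map_smul_sub`).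

That the posterior is the conditional law is Bayes' rule (`condDistrib_ae_eq_posterior`), obtained
from the joint density of the observation and the signal with respect to `volume ⊗ μ₀`. Its
covariance is positive definite because the posterior is absolutely continuous, so no hyperplane
has full mass (`posDef_covMat`).
-/

namespace Diffusion

/-! ### The density of the standard Gaussian measure -/

section GaussianDensity

variable {E : Type*} [NormedAddCommGroup E] [InnerProductSpace ℝ E] [FiniteDimensional ℝ E]
  [MeasurableSpace E] [BorelSpace E]

lemma integrable_exp_neg_sq_norm {b : ℝ} (hb : 0 < b) :
    Integrable (fun x : E => Real.exp (-b * ‖x‖ ^ 2)) := by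
  have h := GaussianFourier.integrable_cexp_neg_mul_sq_norm_add (V := E) (b := (b : ℂ))
    (by simpa using hb) 0 0
  refine h.norm.congr (ae_of_all _ fun x => ?_)
  simp only [zero_mul, add_zero, Complex.norm_exp]
  norm_cast

/-- The standard Gaussian measure has density proportional to `exp (-‖x‖² / 2)`: both sides have the
same characteristic function. -/
lemma stdGaussian_eq_tilted :
    stdGaussian E = (volume : Measure E).tilted (fun x => -‖x‖ ^ 2 / 2) := by
  have hexp : (fun x : E => Real.exp (-‖x‖ ^ 2 / 2)) = fun x => Real.exp (-(1 / 2) * ‖x‖ ^ 2) := by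
    funext x; ring_nf
  have hI : Integrable (fun x : E => Real.exp (-‖x‖ ^ 2 / 2)) := by
    rw [hexp]; exact integrable_exp_neg_sq_norm (by norm_num)
  have := isProbabilityMeasure_tilted hI
  refine Measure.ext_of_charFun ?_
  funext t
  rw [charFun_stdGaussian, charFun_apply, integral_tilted]
  have hZ : 0 < ∫ x : E, Real.exp (-‖x‖ ^ 2 / 2) := integral_exp_pos hI
  have h1 := GaussianFourier.integral_cexp_neg_mul_sq_norm_add (V := E) (b := (1 / 2 : ℂ))
    (by norm_num) Complex.I t
  have h0 := GaussianFourier.integral_cexp_neg_mul_sq_norm (V := E) (b := (1 / 2 : ℂ))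
    (by norm_num)
  have hZc : ((∫ x : E, Real.exp (-‖x‖ ^ 2 / 2) : ℝ) : ℂ) =
      ∫ v : E, Complex.exp (-(1 / 2) * ‖v‖ ^ 2) := by
    rw [← integral_complex_ofReal]
    refine integral_congr_ae (ae_of_all _ fun x => ?_)
    simp only [Complex.ofReal_exp]
    push_cast
    ring_nf
  have hZ0 : ((∫ x : E, Real.exp (-‖x‖ ^ 2 / 2) : ℝ) : ℂ) ≠ 0 := by exact_mod_cast hZ.ne'
  have hnum : ∫ x : E, (Real.exp (-‖x‖ ^ 2 / 2) / ∫ x : E, Real.exp (-‖x‖ ^ 2 / 2)) •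
      Complex.exp (inner ℝ x t * Complex.I) =
      (∫ v : E, Complex.exp (-(1 / 2) * ‖v‖ ^ 2 + Complex.I * inner ℝ t v)) /
        ((∫ x : E, Real.exp (-‖x‖ ^ 2 / 2) : ℝ) : ℂ) := by
    rw [← integral_div]
    refine integral_congr_ae (ae_of_all _ fun x => ?_)
    simp only [Complex.real_smul, Complex.ofReal_div, Complex.ofReal_exp]
    rw [div_mul_eq_mul_div, ← Complex.exp_add, real_inner_comm x t]
    push_cast
    ring_nf
  rw [hnum, h1, ← h0, ← hZc, mul_div_assoc, mul_comm, div_mul_cancel₀ _ hZ0]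
  congr 1
  simp only [Complex.I_sq]
  ring

end GaussianDensity

/-! ### Continuity of the inverse square root at the identity matrix -/

section Matrix
variable {d : ℕ}
open scoped Matrix.Norms.L2Operator in
lemma tendsto_inv_sqrt_one {ι : Type*} {l : Filter ι} {C : ι → Matrix (Fin d) (Fin d) ℝ}
    (hC : ∀ᶠ i in l, (C i).PosSemidef) (hlim : Tendsto C l (𝓝 1)) :
    Tendsto (fun i => (CFC.sqrt (C i))⁻¹) l (𝓝 1) := by
  have h1 : (0 : Matrix (Fin d) (Fin d) ℝ) ≤ 1 := Matrix.PosSemidef.one.nonneg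
  have hs : Tendsto (fun i => CFC.sqrt (C i)) l (𝓝 (CFC.sqrt 1)) := by
    have := (CFC.continuousOn_sqrt (A := Matrix (Fin d) (Fin d) ℝ)) 1 h1
    exact this.tendsto.comp (tendsto_nhdsWithin_iff.2
      ⟨hlim, hC.mono fun i hi => hi.nonneg⟩)
  rw [CFC.sqrt_one] at hs
  have hdet : Tendsto (fun i => (CFC.sqrt (C i)).det) l (𝓝 1) := by
    simpa [Function.comp_def] using
      ((continuous_id.matrix_det).tendsto (1 : Matrix (Fin d) (Fin d) ℝ)).comp hs
  have hadj := ((continuous_id.matrix_adjugate).tendsto (1 : Matrix (Fin d) (Fin d) ℝ)).comp hs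
  simp only [Matrix.inv_def, Ring.inverse_eq_inv']
  simpa using (hdet.inv₀ one_ne_zero).smul hadj

end Matrix

/-! ### Localisation of Gaussian-weighted integrals of an integrable function -/

section Localization

variable {E : Type*} [NormedAddCommGroup E] [InnerProductSpace ℝ E] [FiniteDimensional ℝ E]
  [MeasurableSpace E] [BorelSpace E]

lemma integral_comp_add_smul (g : E → ℝ) (b : E) {a : ℝ} (ha : 0 < a) :
    ∫ u, g (b + a • u) = (a ^ Module.finrank ℝ E)⁻¹ * ∫ z, g z := by
  rw [Measure.integral_comp_smul_of_nonneg volume (fun u => g (b + u)) a (hR := ha.le),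
    integral_add_left_eq_self g b, smul_eq_mul]

lemma integrable_comp_add_smul {g : E → ℝ} (hg : Integrable g) (b : E) {a : ℝ} (ha : 0 < a) :
    Integrable fun u => g (b + a • u) :=
  (hg.comp_add_left b).comp_smul ha.ne'

lemma one_add_sq_mul_exp_le (r : ℝ) :
    (1 + r ^ 2) * Real.exp (-r ^ 2 / 2) ≤ 4 * Real.exp (-(1 / 4) * r ^ 2) := by
  have h : Real.exp (-r ^ 2 / 2) = Real.exp (-(1 / 4) * r ^ 2) * Real.exp (-(r ^ 2 / 4)) := by
    rw [← Real.exp_add]; ring_nf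
  have h2 : (1 + r ^ 2) * Real.exp (-(r ^ 2 / 4)) ≤ 4 := by
    rw [Real.exp_neg, ← div_eq_mul_inv, div_le_iff₀ (Real.exp_pos _)]
    nlinarith [Real.add_one_le_exp (r ^ 2 / 4), sq_nonneg r]
  rw [h]
  nlinarith [Real.exp_pos (-(1 / 4) * r ^ 2)]

/-- The Gaussian tail at distance of order `1 / a` beats the Jacobian `a⁻ⁿ` as `a → 0⁺`. -/
lemma tendsto_inv_pow_mul_exp_neg_div_sq (n : ℕ) {c : ℝ} (hc : 0 < c) :
    Tendsto (fun a : ℝ => (a ^ n)⁻¹ * Real.exp (-(c / a ^ 2))) (𝓝[>] 0) (𝓝 0) := by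
  have h : Tendsto (fun x : ℝ => x ^ n * Real.exp (-(c * x ^ 2))) atTop (𝓝 0) := by
    refine squeeze_zero' (g := fun x => x ^ n * Real.exp (-x)) ?_ ?_
      (Real.tendsto_pow_mul_exp_neg_atTop_nhds_zero n)
    · filter_upwards [eventually_ge_atTop 0] with x hx using by positivity
    · filter_upwards [eventually_ge_atTop 0, eventually_ge_atTop c⁻¹] with x hx hx'
      have : x ≤ c * x ^ 2 := by
        have := mul_le_mul_of_nonneg_left hx' hc.le
        rw [mul_inv_cancel₀ hc.ne'] at this
        nlinarith
      gcongr
  refine (h.comp tendsto_inv_nhdsGT_zero).congr fun a => ?_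
  simp [div_eq_mul_inv]

/-- Zooming in on `p` at the point `y₀` under a Gaussian weight only sees the value `p y₀`. The
function `p` need not be bounded: away from `y₀` the Gaussian weight is at most
`exp (-δ² / (16 a²))`, which absorbs the factor `a⁻ⁿ` in `∫ p (b + a u) du = a⁻ⁿ ∫ p`. -/
lemma tendsto_integral_mul_comp_add_smul {ι : Type*} {l : Filter ι} [l.IsCountablyGenerated]
    {p : E → ℝ} (hp0 : ∀ x, 0 ≤ p x) (hp : Integrable p) {y₀ : E} (hpc : ContinuousAt p y₀)
    {a : ι → ℝ} {b : ι → E} (ha : Tendsto a l (𝓝[>] 0)) (hb : Tendsto b l (𝓝 y₀))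
    {f : ι → E → ℝ} {g : E → ℝ} {C : ℝ} (hC : 0 ≤ C)
    (hfm : ∀ᶠ i in l, AEStronglyMeasurable (f i))
    (hfC : ∀ᶠ i in l, ∀ u, |f i u| ≤ C * (1 + ‖u‖ ^ 2))
    (hlim : ∀ u, Tendsto (fun i => f i u) l (𝓝 (g u))) :
    Tendsto (fun i => ∫ u, f i u * (p (b i + a i • u) * Real.exp (-‖u‖ ^ 2 / 2))) l
      (𝓝 (∫ u, g u * (p y₀ * Real.exp (-‖u‖ ^ 2 / 2)))) := by
  obtain ⟨δ, hδ, hball⟩ : ∃ δ > 0, ∀ z ∈ Metric.ball y₀ δ, p z ≤ p y₀ + 1 := by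
    have := hpc.eventually (gt_mem_nhds (lt_add_one (p y₀)))
    obtain ⟨δ, hδ, h⟩ := Metric.eventually_nhds_iff_ball.1 this
    exact ⟨δ, hδ, fun z hz => (h z hz).le⟩
  have ha0 : Tendsto a l (𝓝 0) := ha.mono_right nhdsWithin_le_nhds
  have hapos : ∀ᶠ i in l, 0 < a i := ha.eventually self_mem_nhdsWithin
  set F : ι → E → ℝ := fun i u => f i u * (p (b i + a i • u) * Real.exp (-‖u‖ ^ 2 / 2)) with hF
  -- The region where `p` is sampled inside the ball on which it is bounded.
  set S : ι → Set E := fun i => (fun u => b i + a i • u) ⁻¹' Metric.ball y₀ δ with hS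
  have hSm : ∀ i, MeasurableSet (S i) := fun i =>
    (by fun_prop : Measurable fun u => b i + a i • u) measurableSet_ball
  have hFm : ∀ᶠ i in l, AEStronglyMeasurable (F i) := by
    filter_upwards [hfm, hapos] with i hi hai
    exact hi.mul ((integrable_comp_add_smul hp (b i) hai).1.mul
      (by fun_prop : Measurable fun u : E => Real.exp (-‖u‖ ^ 2 / 2)).aestronglyMeasurable)
  have hFle : ∀ᶠ i in l, ∀ u, ‖F i u‖ ≤
      C * (4 * Real.exp (-(1 / 4) * ‖u‖ ^ 2)) * p (b i + a i • u) := by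
    filter_upwards [hfC] with i hi u
    simp only [hF, norm_mul, Real.norm_eq_abs, Real.abs_exp, abs_of_nonneg (hp0 _)]
    calc |f i u| * (p (b i + a i • u) * Real.exp (-‖u‖ ^ 2 / 2))
        ≤ C * (1 + ‖u‖ ^ 2) * (p (b i + a i • u) * Real.exp (-‖u‖ ^ 2 / 2)) :=
          mul_le_mul_of_nonneg_right (hi u) (mul_nonneg (hp0 _) (Real.exp_pos _).le)
      _ = C * ((1 + ‖u‖ ^ 2) * Real.exp (-‖u‖ ^ 2 / 2)) * p (b i + a i • u) := by ring
      _ ≤ _ := mul_le_mul_of_nonneg_right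
          (mul_le_mul_of_nonneg_left (one_add_sq_mul_exp_le _) hC) (hp0 _)
  have hboundI : Integrable fun u : E => C * (4 * Real.exp (-(1 / 4) * ‖u‖ ^ 2)) * (p y₀ + 1) :=
    (((integrable_exp_neg_sq_norm (by norm_num)).const_mul 4).const_mul C).mul_const _
  have hin : ∀ᶠ i in l, ∀ u, ‖(S i).indicator (F i) u‖ ≤
      C * (4 * Real.exp (-(1 / 4) * ‖u‖ ^ 2)) * (p y₀ + 1) := by
    filter_upwards [hFle] with i hi u
    by_cases hu : u ∈ S i
    · rw [indicator_of_mem hu]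
      refine (hi u).trans ?_
      gcongr
      exact hball _ hu
    · rw [indicator_of_notMem hu, norm_zero]
      have := hp0 y₀
      positivity
  -- On `S i` dominated convergence applies.
  have hA : Tendsto (fun i => ∫ u, (S i).indicator (F i) u) l
      (𝓝 (∫ u, g u * (p y₀ * Real.exp (-‖u‖ ^ 2 / 2)))) := by
    refine tendsto_integral_filter_of_dominated_convergence _
      (hFm.mono fun i hi => hi.indicator (hSm i)) (hin.mono fun i hi => ae_of_all _ hi) hboundI
      (ae_of_all _ fun u => ?_)
    have hz : Tendsto (fun i => b i + a i • u) l (𝓝 y₀) := by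
      simpa using hb.add (ha0.smul_const u)
    have hmem : ∀ᶠ i in l, u ∈ S i := hz.eventually (Metric.ball_mem_nhds y₀ hδ)
    refine Tendsto.congr' (hmem.mono fun i hi => (indicator_of_mem hi (F i)).symm) ?_
    exact (hlim u).mul ((hpc.tendsto.comp hz).mul_const _)
  -- Off `S i`, once `‖b - y₀‖ < δ / 2`, the norm of `u` is at least `δ / (2 a)`.
  have hout : ∀ᶠ i in l, ∀ u, ‖(S i)ᶜ.indicator (F i) u‖ ≤
      C * (4 * Real.exp (-(δ ^ 2 / 16 / a i ^ 2))) * p (b i + a i • u) := by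
    filter_upwards [hFle, hapos, hb.eventually (Metric.ball_mem_nhds y₀ (half_pos hδ))]
      with i hi hai hbi u
    by_cases hu : u ∈ (S i)ᶜ
    · rw [indicator_of_mem hu]
      refine (hi u).trans ?_
      have hfar : δ ≤ ‖b i + a i • u - y₀‖ := by
        simpa [hS, Metric.mem_ball, dist_eq_norm] using hu
      have hnear : ‖b i - y₀‖ < δ / 2 := by simpa [dist_eq_norm] using hbi
      have hsplit : ‖b i + a i • u - y₀‖ ≤ ‖b i - y₀‖ + a i * ‖u‖ := by
        calc ‖b i + a i • u - y₀‖ = ‖(b i - y₀) + a i • u‖ := by congr 1; abel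
          _ ≤ ‖b i - y₀‖ + ‖a i • u‖ := norm_add_le _ _
          _ = _ := by rw [norm_smul, Real.norm_of_nonneg hai.le]
      have hau : δ / 2 ≤ a i * ‖u‖ := by linarith
      have hsq : δ ^ 2 / 16 / a i ^ 2 ≤ 1 / 4 * ‖u‖ ^ 2 := by
        rw [div_le_iff₀ (by positivity)]
        nlinarith [mul_self_le_mul_self (half_pos hδ).le hau]
      have := hp0 (b i + a i • u)
      gcongr
      linarith
    · rw [indicator_of_notMem hu, norm_zero]
      have := hp0 (b i + a i • u)
      positivity
  have houtI : ∀ᶠ i in l, Integrable fun u =>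
      C * (4 * Real.exp (-(δ ^ 2 / 16 / a i ^ 2))) * p (b i + a i • u) :=
    hapos.mono fun i hi => (integrable_comp_add_smul hp (b i) hi).const_mul _
  have hB : Tendsto (fun i => ∫ u, (S i)ᶜ.indicator (F i) u) l (𝓝 0) := by
    have hlim0 : Tendsto (fun i => C * 4 * (∫ z, p z) * ((a i ^ Module.finrank ℝ E)⁻¹ *
        Real.exp (-(δ ^ 2 / 16 / a i ^ 2)))) l (𝓝 0) := by
      simpa using ((tendsto_inv_pow_mul_exp_neg_div_sq (Module.finrank ℝ E)
        (by positivity : 0 < δ ^ 2 / 16)).comp ha).const_mul (C * 4 * ∫ z, p z)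
    refine squeeze_zero_norm' ?_ hlim0
    filter_upwards [hout, houtI, hapos] with i hi hI hai
    refine (norm_integral_le_of_norm_le hI (ae_of_all _ hi)).trans_eq ?_
    rw [integral_const_mul, integral_comp_add_smul p (b i) hai]
    ring
  have hAB := hA.add hB
  rw [add_zero] at hAB
  refine hAB.congr' ?_
  filter_upwards [hin, hout, houtI, hFm] with i hi ho hI hm
  rw [← integral_add (hboundI.mono' (hm.indicator (hSm i)) (ae_of_all _ hi))
    (hI.mono' (hm.indicator (hSm i).compl) (ae_of_all _ ho))]
  refine integral_congr_ae (ae_of_all _ fun u => ?_)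
  exact congrFun (indicator_self_add_compl (S i) (F i)) u

end Localization

/-! ### Mean, covariance and standardisation of a measure -/

section Standardization

variable {d : ℕ} {ν : Measure (EuclideanSpace ℝ (Fin d))}

lemma memLp_apply {q : ℝ≥0∞} (hν : MemLp id q ν) (i : Fin d) :
    MemLp (fun z : EuclideanSpace ℝ (Fin d) => z i) q ν :=
  (EuclideanSpace.proj (𝕜 := ℝ) i).comp_memLp' hν

lemma meanVec_apply [IsFiniteMeasure ν] (hν : MemLp id 2 ν) (i : Fin d) :
    meanVec ν i = ∫ z, z i ∂ν :=
  ((EuclideanSpace.proj (𝕜 := ℝ) i).integral_comp_comm (hν.integrable one_le_two)).symm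

lemma dotProduct_covMat_mulVec [IsFiniteMeasure ν] (hν : MemLp id 2 ν) (v : Fin d → ℝ) :
    v ⬝ᵥ (covMat ν).mulVec v = Var[fun z => ∑ i, v i * z i; ν] := by
  have hm : ∀ i, MemLp (fun z : EuclideanSpace ℝ (Fin d) => v i * z i) 2 ν :=
    fun i => (memLp_apply hν i).const_mul _
  have haem : AEMeasurable (fun z : EuclideanSpace ℝ (Fin d) => ∑ i, v i * z i) ν := by fun_prop
  rw [← covariance_self haem, covariance_fun_sum_fun_sum hm hm]
  simp only [dotProduct, Matrix.mulVec, covMat, Matrix.of_apply, Finset.mul_sum,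
    covariance_const_mul_left, covariance_const_mul_right]
  refine Finset.sum_congr rfl fun i _ => Finset.sum_congr rfl fun j _ => ?_
  ring

lemma isHermitian_covMat : (covMat ν).IsHermitian := by
  ext i j
  simp [covMat, covariance_comm]

lemma posSemidef_covMat [IsFiniteMeasure ν] (hν : MemLp id 2 ν) : (covMat ν).PosSemidef :=
  .of_dotProduct_mulVec_nonneg isHermitian_covMat fun v => by
    rw [star_trivial, dotProduct_covMat_mulVec hν]
    exact variance_nonneg _ _

lemma volume_hyperplane {v : Fin d → ℝ} (hv : v ≠ 0) (c : ℝ) :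
    volume {z : EuclideanSpace ℝ (Fin d) | ∑ i, v i * z i = c} = 0 := by
  let L : EuclideanSpace ℝ (Fin d) →ₗ[ℝ] ℝ := ∑ i, v i • (EuclideanSpace.projₗ (𝕜 := ℝ) i)
  have hL : ∀ z, L z = ∑ i, v i * z i := fun z => by simp [L]
  let H : AffineSubspace ℝ (EuclideanSpace ℝ (Fin d)) :=
    (AffineSubspace.mk' c ⊥).comap L.toAffineMap
  have hH : ∀ z, z ∈ H ↔ ∑ i, v i * z i = c := fun z => by
    simp [H, AffineSubspace.mem_comap, AffineSubspace.mem_mk', sub_eq_zero, hL]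
  have hne : H ≠ ⊤ := by
    intro htop
    have hall : ∀ z : EuclideanSpace ℝ (Fin d), ∑ i, v i * z i = c := fun z =>
      (hH z).1 (htop ▸ AffineSubspace.mem_top ℝ _ z)
    have h0 : c = 0 := by simpa using (hall 0).symm
    have h1 := hall (WithLp.toLp 2 v)
    rw [h0] at h1
    refine hv (dotProduct_self_eq_zero.1 ?_)
    simpa [dotProduct] using h1
  have := Measure.addHaar_affineSubspace volume H hne
  convert this using 2
  ext z
  exact (hH z).symm

/-- A degenerate covariance would concentrate the measure on a hyperplane. -/
lemma posDef_covMat [IsProbabilityMeasure ν] (hν : MemLp id 2 ν) (hac : ν ≪ volume) :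
    (covMat ν).PosDef := by
  refine .of_dotProduct_mulVec_pos isHermitian_covMat fun v hv => ?_
  rw [star_trivial, dotProduct_covMat_mulVec hν]
  refine (variance_nonneg _ _).lt_of_ne' fun h0 => ?_
  have hL2 : MemLp (fun z : EuclideanSpace ℝ (Fin d) => ∑ i, v i * z i) 2 ν :=
    memLp_finsetSum _ fun i _ => (memLp_apply hν i).const_mul _
  have hev : evariance (fun z : EuclideanSpace ℝ (Fin d) => ∑ i, v i * z i) ν = 0 := by
    rw [← hL2.ofReal_variance_eq, h0, ENNReal.ofReal_zero]
  rw [evariance_eq_zero_iff hL2.1.aemeasurable] at hev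
  have hnull : ∀ᵐ z ∂ν, ¬ (∑ i, v i * z i = ν[fun z => ∑ i, v i * z i]) := by
    refine hac.ae_le (measure_eq_zero_iff_ae_notMem.1 (volume_hyperplane hv _))
  obtain ⟨z, hz, hz'⟩ := (hev.and hnull).exists
  exact hz' hz

lemma measurable_standardize : Measurable (standardize ν) :=
  ((Matrix.toEuclideanLin (CFC.sqrt (covMat ν))⁻¹).continuous_of_finiteDimensional.measurable.comp
    (measurable_id.sub_const _))

lemma meanVec_map_smul_sub [IsProbabilityMeasure ν] (hν : MemLp id 2 ν) (c : ℝ)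
    (b : EuclideanSpace ℝ (Fin d)) :
    meanVec (ν.map fun z => c • (z - b)) = c • (meanVec ν - b) := by
  have hI : Integrable (fun z : EuclideanSpace ℝ (Fin d) => z) ν := hν.integrable one_le_two
  rw [meanVec, integral_map (by fun_prop) (by fun_prop), integral_smul,
    integral_sub hI (integrable_const b), integral_const]
  simp [meanVec]

lemma covMat_map_smul_sub [IsProbabilityMeasure ν] (hν : MemLp id 2 ν) (c : ℝ)
    (b : EuclideanSpace ℝ (Fin d)) :
    covMat (ν.map fun z => c • (z - b)) = (c * c) • covMat ν := by
  ext i j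
  have hI : ∀ i, Integrable (fun z : EuclideanSpace ℝ (Fin d) => z i) ν :=
    fun i => (memLp_apply hν i).integrable one_le_two
  simp only [covMat, Matrix.of_apply, Matrix.smul_apply, smul_eq_mul]
  rw [covariance_map (by fun_prop) (by fun_prop) (by fun_prop)]
  simp only [Function.comp_def, PiLp.smul_apply, PiLp.sub_apply, smul_eq_mul,
    covariance_const_mul_left, covariance_const_mul_right]
  rw [covariance_sub_const_left (hI i), covariance_sub_const_right (hI j), mul_assoc]

/-- The scalar is written `c * c` because rescaling a vector by `c` multiplies its covariance by
`c * c`. -/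
lemma inv_sqrt_smul {C : Matrix (Fin d) (Fin d) ℝ} (hC : C.PosDef) {c : ℝ} (hc : 0 < c) :
    (CFC.sqrt ((c * c) • C))⁻¹ = c⁻¹ • (CFC.sqrt C)⁻¹ := by
  have hS : CFC.sqrt C * CFC.sqrt C = C := CFC.sqrt_mul_sqrt_self C hC.posSemidef.nonneg
  have hsqrt : CFC.sqrt ((c * c) • C) = c • CFC.sqrt C := by
    refine CFC.sqrt_unique ?_
      ((Matrix.nonneg_iff_posSemidef.1 (CFC.sqrt_nonneg C)).smul hc.le).nonneg
    rw [smul_mul_smul_comm, hS]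
  have hdet : IsUnit (CFC.sqrt C).det := by
    refine isUnit_of_mul_isUnit_left (y := (CFC.sqrt C).det) ?_
    rw [← Matrix.det_mul, hS]
    exact hC.det_pos.ne'.isUnit
  rw [hsqrt]
  refine Matrix.inv_eq_left_inv ?_
  rw [smul_mul_smul_comm, inv_mul_cancel₀ hc.ne', Matrix.nonsing_inv_mul _ hdet, one_smul]

/-- Standardisation is unchanged by a change of origin and of scale. -/
lemma standardize_map_smul_sub [IsProbabilityMeasure ν] (hν : MemLp id 2 ν) (hac : ν ≪ volume)
    {c : ℝ} (hc : 0 < c) (b z : EuclideanSpace ℝ (Fin d)) :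
    standardize (ν.map fun z => c • (z - b)) (c • (z - b)) = standardize ν z := by
  rw [standardize, standardize, meanVec_map_smul_sub hν, covMat_map_smul_sub hν,
    inv_sqrt_smul (posDef_covMat hν hac) hc, ← smul_sub, sub_sub_sub_cancel_right, map_smul,
    map_smul, LinearMap.smul_apply, smul_smul, mul_inv_cancel₀ hc.ne', one_smul]

lemma tendsto_of_forall_apply {ι : Type*} {l : Filter ι} {x : ι → EuclideanSpace ℝ (Fin d)}
    {y : EuclideanSpace ℝ (Fin d)} (h : ∀ k, Tendsto (fun i => x i k) l (𝓝 (y k))) :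
    Tendsto x l (𝓝 y) :=
  ((PiLp.continuous_toLp 2 _).tendsto (WithLp.ofLp y)).comp
    (tendsto_pi_nhds.2 h : Tendsto (fun i => WithLp.ofLp (x i)) l (𝓝 (WithLp.ofLp y)))

/-- If the first and second moments tend to those of the standard Gaussian, then the
standardisation maps tend pointwise to the identity. -/
lemma tendsto_standardize {ι : Type*} {l : Filter ι} {ν : ι → Measure (EuclideanSpace ℝ (Fin d))}
    [∀ i, IsProbabilityMeasure (ν i)] (hν : ∀ᶠ i in l, MemLp id 2 (ν i))
    (hmean : ∀ k, Tendsto (fun i => ∫ z, z k ∂(ν i)) l (𝓝 0))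
    (hmul : ∀ j k, Tendsto (fun i => ∫ z, z j * z k ∂(ν i)) l
      (𝓝 ((1 : Matrix (Fin d) (Fin d) ℝ) j k)))
    (u : EuclideanSpace ℝ (Fin d)) :
    Tendsto (fun i => standardize (ν i) u) l (𝓝 u) := by
  have hm : ∀ k, Tendsto (fun i => meanVec (ν i) k) l (𝓝 0) := fun k =>
    (hmean k).congr' (hν.mono fun i hi => (meanVec_apply hi k).symm)
  have hcov : Tendsto (fun i => covMat (ν i)) l (𝓝 1) := by
    refine tendsto_pi_nhds.2 fun j => tendsto_pi_nhds.2 fun k => ?_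
    have := (hmul j k).sub ((hmean j).mul (hmean k))
    rw [mul_zero, sub_zero] at this
    refine this.congr' ?_
    filter_upwards [hν] with i hi
    exact (covariance_eq_sub (memLp_apply hi j) (memLp_apply hi k)).symm
  have hinv := tendsto_inv_sqrt_one (hν.mono fun i hi => posSemidef_covMat hi) hcov
  refine tendsto_of_forall_apply fun j => ?_
  have hentry : ∀ k, Tendsto (fun i => (CFC.sqrt (covMat (ν i)))⁻¹ j k) l
      (𝓝 ((1 : Matrix (Fin d) (Fin d) ℝ) j k)) :=
    fun k => tendsto_pi_nhds.1 (tendsto_pi_nhds.1 hinv j) k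
  have hsum := tendsto_finsetSum Finset.univ fun k (_ : k ∈ Finset.univ) =>
    (hentry k).mul ((tendsto_const_nhds (x := u k)).sub (hm k))
  have hval : ∑ k, (1 : Matrix (Fin d) (Fin d) ℝ) j k * (u k - 0) = u j := by
    simp [Matrix.one_apply]
  rw [hval] at hsum
  exact hsum

end Standardization

/-! ### Moments and measurability of the posterior -/

section Posterior

variable {d : ℕ} {μ₀ : Measure (EuclideanSpace ℝ (Fin d))} [IsProbabilityMeasure μ₀] {s σ : ℝ}

lemma measurable_exp_neg_sq_norm_sub (s σ : ℝ) :
    Measurable fun q : EuclideanSpace ℝ (Fin d) × EuclideanSpace ℝ (Fin d) =>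
      Real.exp (-‖q.1 - s • q.2‖ ^ 2 / (2 * σ ^ 2)) := by
  fun_prop

lemma integrable_exp_neg_sq_norm_sub (s σ : ℝ) (y : EuclideanSpace ℝ (Fin d)) :
    Integrable (fun z => Real.exp (-‖y - s • z‖ ^ 2 / (2 * σ ^ 2))) μ₀ := by
  refine Integrable.of_bound (C := 1)
    (by fun_prop : Measurable fun z : EuclideanSpace ℝ (Fin d) =>
      Real.exp (-‖y - s • z‖ ^ 2 / (2 * σ ^ 2))).aestronglyMeasurable (ae_of_all _ fun z => ?_)
  rw [Real.norm_eq_abs, Real.abs_exp, Real.exp_le_one_iff]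
  exact div_nonpos_of_nonpos_of_nonneg (by simp) (by positivity)

/-- No moment of the prior is needed: the likelihood times `‖z‖²` is bounded in `z`. -/
lemma memLp_two_posterior (hs : 0 < s) (hσ : 0 < σ) (y : EuclideanSpace ℝ (Fin d)) :
    MemLp id 2 (posterior μ₀ s σ y) := by
  rw [memLp_two_iff_integrable_sq_norm measurable_id.aestronglyMeasurable, posterior,
    integrable_tilted_iff (integrable_exp_neg_sq_norm_sub s σ y)]
  refine Integrable.of_bound (C := 2 * (‖y‖ ^ 2 + 2 * σ ^ 2) / s ^ 2)
    (by fun_prop : Measurable fun z : EuclideanSpace ℝ (Fin d) =>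
      Real.exp (-‖y - s • z‖ ^ 2 / (2 * σ ^ 2)) • ‖id z‖ ^ 2).aestronglyMeasurable
    (ae_of_all _ fun z => ?_)
  simp only [id, smul_eq_mul, norm_mul, Real.norm_eq_abs, Real.abs_exp, abs_pow, abs_norm]
  set r := ‖y - s • z‖
  have hz : s * ‖z‖ ≤ ‖y‖ + r := by
    calc s * ‖z‖ = ‖y - (y - s • z)‖ := by rw [sub_sub_cancel, norm_smul, Real.norm_of_nonneg hs.le]
      _ ≤ _ := norm_sub_le _ _
  have hz2 : (s * ‖z‖) ^ 2 ≤ 2 * (‖y‖ ^ 2 + r ^ 2) := by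
    have := pow_le_pow_left₀ (by positivity) hz 2
    nlinarith [sq_nonneg (‖y‖ - r)]
  have he1 : Real.exp (-r ^ 2 / (2 * σ ^ 2)) ≤ 1 := Real.exp_le_one_iff.2
    (div_nonpos_of_nonpos_of_nonneg (neg_nonpos.2 (sq_nonneg r)) (by positivity))
  have he2 : Real.exp (-r ^ 2 / (2 * σ ^ 2)) * r ^ 2 ≤ 2 * σ ^ 2 := by
    rw [neg_div, Real.exp_neg, inv_mul_le_iff₀ (Real.exp_pos _)]
    have := Real.add_one_le_exp (r ^ 2 / (2 * σ ^ 2))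
    calc r ^ 2 = r ^ 2 / (2 * σ ^ 2) * (2 * σ ^ 2) := by field_simp
      _ ≤ _ := by gcongr; linarith
  rw [le_div_iff₀ (by positivity)]
  have he0 := Real.exp_pos (-r ^ 2 / (2 * σ ^ 2))
  calc Real.exp (-r ^ 2 / (2 * σ ^ 2)) * ‖z‖ ^ 2 * s ^ 2
      = Real.exp (-r ^ 2 / (2 * σ ^ 2)) * (s * ‖z‖) ^ 2 := by ring
    _ ≤ Real.exp (-r ^ 2 / (2 * σ ^ 2)) * (2 * (‖y‖ ^ 2 + r ^ 2)) :=
          mul_le_mul_of_nonneg_left hz2 he0.le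
    _ ≤ _ := by nlinarith [sq_nonneg ‖y‖]

lemma posterior_absolutelyContinuous {μ₀ : Measure (EuclideanSpace ℝ (Fin d))}
    (hμ₀ : μ₀ ≪ volume) (s σ : ℝ) (y : EuclideanSpace ℝ (Fin d)) : posterior μ₀ s σ y ≪ volume :=
  (tilted_absolutelyContinuous _ _).trans hμ₀

/-- The posterior as a Markov kernel from observations to signals. -/
noncomputable def posteriorKernel (μ₀ : Measure (EuclideanSpace ℝ (Fin d)))
    [IsProbabilityMeasure μ₀] (s σ : ℝ) :
    Kernel (EuclideanSpace ℝ (Fin d)) (EuclideanSpace ℝ (Fin d)) where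
  toFun := posterior μ₀ s σ
  measurable' := by
    refine Measure.measurable_of_measurable_coe _ fun A hA => ?_
    simp only [posterior, tilted_apply' _ _ hA]
    have hZ : Measurable fun y : EuclideanSpace ℝ (Fin d) =>
        ∫ z, Real.exp (-‖y - s • z‖ ^ 2 / (2 * σ ^ 2)) ∂μ₀ :=
      ((measurable_exp_neg_sq_norm_sub s σ).stronglyMeasurable.integral_prod_right).measurable
    exact Measurable.lintegral_prod_right'
      (f := fun q : EuclideanSpace ℝ (Fin d) × EuclideanSpace ℝ (Fin d) =>
        ENNReal.ofReal (Real.exp (-‖q.1 - s • q.2‖ ^ 2 / (2 * σ ^ 2)) /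
          ∫ z, Real.exp (-‖q.1 - s • z‖ ^ 2 / (2 * σ ^ 2)) ∂μ₀))
      ((measurable_exp_neg_sq_norm_sub s σ).div (hZ.comp measurable_fst)).ennreal_ofReal

instance isMarkovKernel_posteriorKernel (s σ : ℝ) : IsMarkovKernel (posteriorKernel μ₀ s σ) :=
  ⟨fun y => isProbabilityMeasure_posterior μ₀ s σ y⟩

end Posterior

/-! ### Bayes' rule -/

section Bayes

variable {E : Type*} [NormedAddCommGroup E] [InnerProductSpace ℝ E] [FiniteDimensional ℝ E]
  [MeasurableSpace E] [BorelSpace E]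

lemma lintegral_comp_add_smul {g : E → ℝ≥0∞} (hg : Measurable g) (b : E) {a : ℝ} (ha : 0 < a) :
    ∫⁻ u, g (b + a • u) = ENNReal.ofReal (a ^ Module.finrank ℝ E)⁻¹ * ∫⁻ z, g z := by
  rw [← lintegral_add_left_eq_self g b,
    ← lintegral_map (f := fun u => g (b + u)) (by fun_prop) (measurable_const_smul a),
    Measure.map_addHaar_smul _ ha.ne', lintegral_smul_measure, abs_of_pos (by positivity),
    smul_eq_mul]

/-- The law of `m + σ • e`, with `e` standard Gaussian, has the Gaussian density centred at `m`. -/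
lemma lintegral_add_smul_stdGaussian {h : E → ℝ≥0∞} (hh : Measurable h) (m : E) {σ : ℝ}
    (hσ : 0 < σ) :
    ∫⁻ e, h (m + σ • e) ∂(stdGaussian E) =
      ∫⁻ y, ENNReal.ofReal ((σ ^ Module.finrank ℝ E)⁻¹ / (∫ x : E, Real.exp (-‖x‖ ^ 2 / 2)) *
        Real.exp (-‖y - m‖ ^ 2 / (2 * σ ^ 2))) * h y := by
  set Z := ∫ x : E, Real.exp (-‖x‖ ^ 2 / 2)
  have hZ : 0 ≤ Z := integral_nonneg fun x => (Real.exp_pos _).le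
  have key := lintegral_comp_add_smul
    (g := fun y => ENNReal.ofReal (Real.exp (-‖y - m‖ ^ 2 / (2 * σ ^ 2)) / Z) * h y)
    (by fun_prop) m hσ
  rw [stdGaussian_eq_tilted, lintegral_tilted]
  have hl : ∀ e : E, Real.exp (-‖e‖ ^ 2 / 2) =
      Real.exp (-‖m + σ • e - m‖ ^ 2 / (2 * σ ^ 2)) := fun e => by
    rw [add_sub_cancel_left, norm_smul, Real.norm_of_nonneg hσ.le]
    congr 1
    field_simp
  have hcongr : ∫⁻ e, ENNReal.ofReal (Real.exp (-‖e‖ ^ 2 / 2) / Z) * h (m + σ • e) =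
      ∫⁻ e, ENNReal.ofReal (Real.exp (-‖m + σ • e - m‖ ^ 2 / (2 * σ ^ 2)) / Z) * h (m + σ • e) :=
    lintegral_congr fun e => by rw [hl e]
  rw [hcongr, key, ← lintegral_const_mul _ (by fun_prop)]
  refine lintegral_congr fun y => ?_
  rw [← mul_assoc, ← ENNReal.ofReal_mul (by positivity)]
  congr 2
  ring

variable {Ω : Type*} [MeasurableSpace Ω] {P : Measure Ω} [IsProbabilityMeasure P]
  {x₀ ε : Ω → E} {μ₀ : Measure E} {s σ : ℝ}

/-- The joint law of the observation `s • x₀ + σ • ε` and the signal `x₀` has, with respect to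
`volume ⊗ μ₀`, the Gaussian likelihood as its density. -/
lemma lintegral_comp_observation_signal [IsProbabilityMeasure μ₀] (hσ : 0 < σ)
    (hx₀ : HasLaw x₀ μ₀ P) (hε : HasLaw ε (stdGaussian E) P) (hindep : IndepFun x₀ ε P)
    {G : E × E → ℝ≥0∞} (hG : Measurable G) :
    ∫⁻ w, G (s • x₀ w + σ • ε w, x₀ w) ∂P =
      ∫⁻ y, ∫⁻ z, ENNReal.ofReal ((σ ^ Module.finrank ℝ E)⁻¹ /
          (∫ x : E, Real.exp (-‖x‖ ^ 2 / 2)) *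
        Real.exp (-‖y - s • z‖ ^ 2 / (2 * σ ^ 2))) * G (y, z) ∂μ₀ := by
  have hlaw : P.map (fun w => (x₀ w, ε w)) = μ₀.prod (stdGaussian E) := by
    rw [(indepFun_iff_map_prod_eq_prod_map_map hx₀.aemeasurable hε.aemeasurable).1 hindep,
      hx₀.map_eq, hε.map_eq]
  have hGm : Measurable fun q : E × E => G (s • q.1 + σ • q.2, q.1) := by fun_prop
  calc ∫⁻ w, G (s • x₀ w + σ • ε w, x₀ w) ∂P
      = ∫⁻ q, G (s • q.1 + σ • q.2, q.1) ∂(P.map fun w => (x₀ w, ε w)) :=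
        (lintegral_map' hGm.aemeasurable (hx₀.aemeasurable.prodMk hε.aemeasurable)).symm
    _ = ∫⁻ z, ∫⁻ e, G (s • z + σ • e, z) ∂(stdGaussian E) ∂μ₀ := by
        rw [hlaw, lintegral_prod _ hGm.aemeasurable]
    _ = _ := by
        refine (lintegral_congr fun z => lintegral_add_smul_stdGaussian
          (h := fun y => G (y, z)) (by fun_prop) (s • z) hσ).trans
          (lintegral_lintegral_swap (Measurable.aemeasurable ?_))
        fun_prop

end Bayes

section BayesEuclidean

variable {d : ℕ} {Ω : Type*} [MeasurableSpace Ω] {P : Measure Ω} [IsProbabilityMeasure P]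
  {x₀ ε : Ω → EuclideanSpace ℝ (Fin d)} {μ₀ : Measure (EuclideanSpace ℝ (Fin d))}
  [IsProbabilityMeasure μ₀] {s σ : ℝ}

/-- The law of the observation and the posterior kernel disintegrate the joint law of the observation
and the signal: the evidence `∫ exp (-‖y - s z‖² / (2 σ²)) dμ₀(z)`, which is the density of the
observation up to a constant, cancels the normalising constant of the posterior. -/
lemma map_observation_signal_eq_compProd (hσ : 0 < σ) (hx₀ : HasLaw x₀ μ₀ P)
    (hε : HasLaw ε (stdGaussian (EuclideanSpace ℝ (Fin d))) P) (hindep : IndepFun x₀ ε P) :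
    P.map (fun w => (s • x₀ w + σ • ε w, x₀ w)) =
      P.map (fun w => s • x₀ w + σ • ε w) ⊗ₘ posteriorKernel μ₀ s σ := by
  have hXm : AEMeasurable (fun w => s • x₀ w + σ • ε w) P :=
    (hx₀.aemeasurable.const_smul s).add (hε.aemeasurable.const_smul σ)
  refine Measure.ext_of_lintegral _ fun G hG => ?_
  have hH : Measurable fun y => ∫⁻ z, G (y, z) ∂(posteriorKernel μ₀ s σ y) :=
    hG.lintegral_kernel_prod_right'
  rw [lintegral_map' hG.aemeasurable (hXm.prodMk hx₀.aemeasurable), Measure.lintegral_compProd hG,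
    lintegral_map' hH.aemeasurable hXm, lintegral_comp_observation_signal hσ hx₀ hε hindep hG]
  refine Eq.trans ?_
    (lintegral_comp_observation_signal hσ hx₀ hε hindep (hH.comp measurable_fst)).symm
  simp only [Function.comp_apply]
  refine lintegral_congr fun y => ?_
  set κ := (σ ^ Module.finrank ℝ (EuclideanSpace ℝ (Fin d)))⁻¹ /
    (∫ x : EuclideanSpace ℝ (Fin d), Real.exp (-‖x‖ ^ 2 / 2))
  have hκ0 : 0 ≤ κ := div_nonneg (by positivity) (integral_nonneg fun x => (Real.exp_pos _).le)
  have hI : Integrable (fun z => Real.exp (-‖y - s • z‖ ^ 2 / (2 * σ ^ 2))) μ₀ :=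
    integrable_exp_neg_sq_norm_sub s σ y
  have hZ : 0 < ∫ z, Real.exp (-‖y - s • z‖ ^ 2 / (2 * σ ^ 2)) ∂μ₀ := integral_exp_pos hI
  rw [lintegral_mul_const _ (by fun_prop),
    ← ofReal_integral_eq_lintegral_ofReal (hI.const_mul κ)
      (ae_of_all _ fun z => mul_nonneg hκ0 (Real.exp_pos _).le), integral_const_mul]
  change _ = _ * ∫⁻ z, G (y, z) ∂(posterior μ₀ s σ y)
  rw [posterior, lintegral_tilted, ← lintegral_const_mul _ (by fun_prop)]
  refine lintegral_congr fun z => ?_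
  rw [← mul_assoc, ← ENNReal.ofReal_mul (mul_nonneg hκ0 hZ.le)]
  congr 2
  rw [mul_assoc, mul_div_assoc', mul_div_cancel_left₀ _ hZ.ne']

/-- Bayes' rule. -/
lemma condDistrib_ae_eq_posterior (hσ : 0 < σ) (hx₀ : HasLaw x₀ μ₀ P)
    (hε : HasLaw ε (stdGaussian (EuclideanSpace ℝ (Fin d))) P) (hindep : IndepFun x₀ ε P) :
    ∀ᵐ y ∂(P.map fun w => s • x₀ w + σ • ε w),
      condDistrib x₀ (fun w => s • x₀ w + σ • ε w) P y = posterior μ₀ s σ y :=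
  condDistrib_ae_eq_of_measure_eq_compProd _ hx₀.aemeasurable
    (map_observation_signal_eq_compProd hσ hx₀ hε hindep)

end BayesEuclidean

/-! ### Asymptotic normality of the posterior -/

section Limit

variable {d : ℕ} {μ₀ : Measure (EuclideanSpace ℝ (Fin d))} {p : EuclideanSpace ℝ (Fin d) → ℝ}

lemma integral_withDensity_ofReal (hp0 : ∀ x, 0 ≤ p x) (hpm : Measurable p)
    (hμ₀ : μ₀ = volume.withDensity fun x => ENNReal.ofReal (p x))
    (g : EuclideanSpace ℝ (Fin d) → ℝ) : ∫ z, g z ∂μ₀ = ∫ z, g z * p z := by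
  rw [hμ₀, integral_withDensity_eq_integral_toReal_smul hpm.ennreal_ofReal
    (ae_of_all _ fun _ => ENNReal.ofReal_lt_top)]
  refine integral_congr_ae (ae_of_all _ fun z => ?_)
  simp only [ENNReal.toReal_ofReal (hp0 z), smul_eq_mul, mul_comm]

/-- In the coordinate `u = (s z - y) / σ` the posterior has a density proportional to
`p (s⁻¹ y + (σ / s) u) exp (-‖u‖² / 2)`. -/
lemma integral_posterior (hp0 : ∀ x, 0 ≤ p x) (hpm : Measurable p)
    (hμ₀ : μ₀ = volume.withDensity fun x => ENNReal.ofReal (p x)) {s σ : ℝ} (hs : 0 < s)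
    (hσ : 0 < σ) (y : EuclideanSpace ℝ (Fin d)) (f : EuclideanSpace ℝ (Fin d) → ℝ) :
    ∫ z, f ((s / σ) • (z - s⁻¹ • y)) ∂(posterior μ₀ s σ y) =
      (∫ u, f u * (p (s⁻¹ • y + (σ / s) • u) * Real.exp (-‖u‖ ^ 2 / 2))) /
        ∫ u, 1 * (p (s⁻¹ • y + (σ / s) • u) * Real.exp (-‖u‖ ^ 2 / 2)) := by
  have ha : 0 < σ / s := div_pos hσ hs
  have key : ∀ f : EuclideanSpace ℝ (Fin d) → ℝ,
      ∫ u, f u * (p (s⁻¹ • y + (σ / s) • u) * Real.exp (-‖u‖ ^ 2 / 2)) =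
      ((σ / s) ^ Module.finrank ℝ (EuclideanSpace ℝ (Fin d)))⁻¹ *
        ∫ z, f ((s / σ) • (z - s⁻¹ • y)) * Real.exp (-‖y - s • z‖ ^ 2 / (2 * σ ^ 2)) ∂μ₀ := by
    intro f
    rw [integral_withDensity_ofReal hp0 hpm hμ₀, ← integral_comp_add_smul _ (s⁻¹ • y) ha]
    refine integral_congr_ae (ae_of_all _ fun u => ?_)
    have h1 : (s / σ) • (s⁻¹ • y + (σ / s) • u - s⁻¹ • y) = u := by
      rw [add_sub_cancel_left, smul_smul, div_mul_div_cancel₀ hσ.ne', div_self hs.ne', one_smul]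
    have h2 : y - s • (s⁻¹ • y + (σ / s) • u) = -(σ • u) := by
      rw [smul_add, smul_inv_smul₀ hs.ne', smul_smul, mul_div_cancel₀ _ hs.ne']
      abel
    simp only [h1, h2, norm_neg, norm_smul, Real.norm_of_nonneg hσ.le]
    have h3 : -(σ * ‖u‖) ^ 2 / (2 * σ ^ 2) = -‖u‖ ^ 2 / 2 := by field_simp
    rw [h3]
    ring
  rw [key, key, mul_div_mul_left _ _ (by positivity), posterior, integral_tilted, ← integral_div]
  refine integral_congr_ae (ae_of_all _ fun z => ?_)
  simp only [one_mul, smul_eq_mul]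
  ring

lemma integral_stdGaussian (f : EuclideanSpace ℝ (Fin d) → ℝ) :
    ∫ u, f u ∂(stdGaussian (EuclideanSpace ℝ (Fin d))) =
      (∫ u, f u * Real.exp (-‖u‖ ^ 2 / 2)) /
        ∫ u : EuclideanSpace ℝ (Fin d), Real.exp (-‖u‖ ^ 2 / 2) := by
  rw [stdGaussian_eq_tilted, integral_tilted, ← integral_div]
  refine integral_congr_ae (ae_of_all _ fun z => ?_)
  simp only [smul_eq_mul]
  ring

variable {ι : Type*} {l : Filter ι} [l.IsCountablyGenerated] {s σ : ι → ℝ}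
  {y : ι → EuclideanSpace ℝ (Fin d)} {y₀ : EuclideanSpace ℝ (Fin d)}

/-- The posterior, seen in the coordinate `u = (s z - y) / σ`, converges to the standard Gaussian,
even when tested against functions of quadratic growth which vary along the limit. -/
lemma tendsto_integral_posterior (hp0 : ∀ x, 0 ≤ p x) (hp : Integrable p) (hpm : Measurable p)
    (hpc : ContinuousAt p y₀) (hpy : 0 < p y₀)
    (hμ₀ : μ₀ = volume.withDensity fun x => ENNReal.ofReal (p x))
    (hs : Tendsto s l (𝓝 1)) (hσ : Tendsto σ l (𝓝[>] 0)) (hy : Tendsto y l (𝓝 y₀))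
    {f : ι → EuclideanSpace ℝ (Fin d) → ℝ} {g : EuclideanSpace ℝ (Fin d) → ℝ} {C : ℝ} (hC : 0 ≤ C)
    (hfm : ∀ᶠ i in l, AEStronglyMeasurable (f i))
    (hfC : ∀ᶠ i in l, ∀ u, |f i u| ≤ C * (1 + ‖u‖ ^ 2))
    (hlim : ∀ u, Tendsto (fun i => f i u) l (𝓝 (g u))) :
    Tendsto (fun i => ∫ z, f i ((s i / σ i) • (z - (s i)⁻¹ • y i)) ∂(posterior μ₀ (s i) (σ i) (y i)))
      l (𝓝 (∫ u, g u ∂(stdGaussian (EuclideanSpace ℝ (Fin d))))) := by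
  have hs0 : ∀ᶠ i in l, 0 < s i := hs.eventually (lt_mem_nhds one_pos)
  have hσ0 : ∀ᶠ i in l, 0 < σ i := hσ.eventually self_mem_nhdsWithin
  have ha : Tendsto (fun i => σ i / s i) l (𝓝[>] 0) := by
    refine tendsto_nhdsWithin_iff.2 ⟨?_, ?_⟩
    · simpa [Pi.div_def] using (hσ.mono_right nhdsWithin_le_nhds).div hs one_ne_zero
    · filter_upwards [hs0, hσ0] with i h1 h2 using div_pos h2 h1
  have hb : Tendsto (fun i => (s i)⁻¹ • y i) l (𝓝 y₀) := by
    simpa using (hs.inv₀ one_ne_zero).smul hy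
  have hnum := tendsto_integral_mul_comp_add_smul hp0 hp hpc ha hb hC hfm hfC hlim
  have hden := tendsto_integral_mul_comp_add_smul hp0 hp hpc ha hb
    (f := fun _ _ => 1) (g := fun _ => 1) zero_le_one
    (Eventually.of_forall fun _ => aestronglyMeasurable_const)
    (Eventually.of_forall fun _ u => by simp) (fun _ => tendsto_const_nhds)
  have hmul : ∀ f : EuclideanSpace ℝ (Fin d) → ℝ,
      ∫ u, f u * (p y₀ * Real.exp (-‖u‖ ^ 2 / 2)) =
      p y₀ * ∫ u, f u * Real.exp (-‖u‖ ^ 2 / 2) := fun f => by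
    rw [← integral_const_mul]
    refine integral_congr_ae (ae_of_all _ fun u => ?_)
    simp only
    ring
  have hZ : 0 < ∫ u : EuclideanSpace ℝ (Fin d), Real.exp (-‖u‖ ^ 2 / 2) := by
    refine integral_exp_pos ?_
    refine (integrable_exp_neg_sq_norm (b := 1 / 2) (by norm_num)).congr (ae_of_all _ fun u => ?_)
    simp only
    ring_nf
  rw [hmul] at hnum
  rw [hmul] at hden
  simp only [one_mul (Real.exp _)] at hden
  have hdiv := hnum.div hden (mul_pos hpy hZ).ne'
  rw [mul_div_mul_left _ _ hpy.ne', ← integral_stdGaussian] at hdiv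
  refine hdiv.congr' ?_
  filter_upwards [hs0, hσ0] with i h1 h2
  exact (integral_posterior hp0 hpm hμ₀ h1 h2 (y i) (f i)).symm

lemma integral_apply_stdGaussian (k : Fin d) :
    ∫ u, u k ∂(stdGaussian (EuclideanSpace ℝ (Fin d))) = 0 :=
  integral_strongDual_stdGaussian (EuclideanSpace.proj (𝕜 := ℝ) k)

lemma integral_apply_mul_apply_stdGaussian (j k : Fin d) :
    ∫ u, u j * u k ∂(stdGaussian (EuclideanSpace ℝ (Fin d))) =
      (1 : Matrix (Fin d) (Fin d) ℝ) j k := by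
  have h := covarianceBilin_apply (μ := stdGaussian (EuclideanSpace ℝ (Fin d)))
    IsGaussian.memLp_two_id (EuclideanSpace.basisFun (Fin d) ℝ j)
    (EuclideanSpace.basisFun (Fin d) ℝ k)
  rw [covarianceBilin_stdGaussian] at h
  simp only [id_eq, integral_id_stdGaussian, sub_zero, EuclideanSpace.basisFun_inner] at h
  rw [← h, innerSL_apply_apply ℝ, OrthonormalBasis.inner_eq_ite, Matrix.one_apply]

/-- Asymptotic normality of the posterior: if `y i → y₀` and the prior density is continuous and
positive at `y₀`, then the standardised posterior converges to the standard Gaussian. -/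
theorem tendstoInDistribution_standardize_posterior [IsProbabilityMeasure μ₀]
    (hp0 : ∀ x, 0 ≤ p x) (hpm : Measurable p)
    (hpc : ContinuousAt p y₀) (hpy : 0 < p y₀)
    (hμ₀ : μ₀ = volume.withDensity fun x => ENNReal.ofReal (p x))
    (hs : Tendsto s l (𝓝 1)) (hσ : Tendsto σ l (𝓝[>] 0)) (hy : Tendsto y l (𝓝 y₀)) :
    TendstoInDistribution (fun i => standardize (posterior μ₀ (s i) (σ i) (y i))) l id
      (fun i => posterior μ₀ (s i) (σ i) (y i)) (stdGaussian (EuclideanSpace ℝ (Fin d))) := by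
  have hp : Integrable p := by
    refine ⟨hpm.aestronglyMeasurable, ?_⟩
    have h1 : ∫⁻ x, ENNReal.ofReal (p x) = 1 := by
      rw [← setLIntegral_univ, ← withDensity_apply _ MeasurableSet.univ, ← hμ₀, measure_univ]
    rw [hasFiniteIntegral_iff_ofReal (ae_of_all _ hp0), h1]
    exact ENNReal.one_lt_top
  have hs0 : ∀ᶠ i in l, 0 < s i := hs.eventually (lt_mem_nhds one_pos)
  have hσ0 : ∀ᶠ i in l, 0 < σ i := hσ.eventually self_mem_nhdsWithin
  have hac : μ₀ ≪ volume := hμ₀ ▸ withDensity_absolutelyContinuous _ _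
  set ψ := fun i => posterior μ₀ (s i) (σ i) (y i)
  set T : ι → EuclideanSpace ℝ (Fin d) → EuclideanSpace ℝ (Fin d) :=
    fun i z => (s i / σ i) • (z - (s i)⁻¹ • y i)
  have hTm : ∀ i, Measurable (T i) := fun i => by fun_prop
  have hmem : ∀ᶠ i in l, MemLp id 2 (ψ i) := by
    filter_upwards [hs0, hσ0] with i h1 h2 using memLp_two_posterior h1 h2 (y i)
  -- The posterior in the coordinate `u = (s z - y) / σ`; it has the same standardisation.
  let ν : ι → Measure (EuclideanSpace ℝ (Fin d)) := fun i => (ψ i).map (T i)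
  have : ∀ i, IsProbabilityMeasure (ν i) := fun i =>
    Measure.isProbabilityMeasure_map (hTm i).aemeasurable
  have hlimit : ∀ {f : ι → EuclideanSpace ℝ (Fin d) → ℝ} {g : EuclideanSpace ℝ (Fin d) → ℝ}
      {C : ℝ}, 0 ≤ C → (∀ i, Measurable (f i)) → (∀ i u, |f i u| ≤ C * (1 + ‖u‖ ^ 2)) →
      (∀ u, Tendsto (fun i => f i u) l (𝓝 (g u))) →
      Tendsto (fun i => ∫ u, f i u ∂(ν i)) l
        (𝓝 (∫ u, g u ∂(stdGaussian (EuclideanSpace ℝ (Fin d))))) := by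
    intro f g C hC hfm hfC hlim
    refine (tendsto_integral_posterior hp0 hp hpm hpc hpy hμ₀ hs hσ hy hC
      (Eventually.of_forall fun i => (hfm i).aestronglyMeasurable)
      (Eventually.of_forall hfC) hlim).congr fun i => ?_
    exact (integral_map (hTm i).aemeasurable (hfm i).aestronglyMeasurable).symm
  have hle : ∀ (u : EuclideanSpace ℝ (Fin d)) k, |u k| ≤ ‖u‖ := fun u k =>
    PiLp.norm_apply_le u k
  -- Test functions `u k` and `u j * u k` give convergence of the mean and of the covariance.
  have hstd : ∀ u, Tendsto (fun i => standardize (ν i) u) l (𝓝 u) := by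
    refine tendsto_standardize ?_ (fun k => ?_) (fun j k => ?_)
    · filter_upwards [hmem] with i hi
      refine (memLp_map_measure_iff aestronglyMeasurable_id (hTm i).aemeasurable).2 ?_
      exact (hi.sub (memLp_const ((s i)⁻¹ • y i))).const_smul (s i / σ i)
    · rw [← integral_apply_stdGaussian k]
      refine hlimit zero_le_one (fun _ => by fun_prop) (fun _ u => ?_) fun _ => tendsto_const_nhds
      nlinarith [hle u k, sq_nonneg (‖u‖ - 1), sq_nonneg ‖u‖]
    · rw [← integral_apply_mul_apply_stdGaussian j k]
      refine hlimit zero_le_one (fun _ => by fun_prop) (fun _ u => ?_) fun _ => tendsto_const_nhds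
      rw [abs_mul]
      nlinarith [mul_le_mul (hle u j) (hle u k) (abs_nonneg _) (norm_nonneg _)]
  refine ⟨fun i => measurable_standardize.aemeasurable, aemeasurable_id, ?_⟩
  refine ProbabilityMeasure.tendsto_iff_forall_integral_tendsto.2 fun f => ?_
  simp only [ProbabilityMeasure.coe_mk, Measure.map_id]
  -- The standardisation depends on `i` but tends pointwise to the identity, so that it can be
  -- absorbed into a varying test function.
  refine (hlimit (f := fun i u => f (standardize (ν i) u)) (g := f) (C := ‖f‖) (norm_nonneg _)
    (fun i => f.continuous.measurable.comp measurable_standardize) (fun i u => ?_)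
    fun u => (f.continuous.tendsto u).comp (hstd u)).congr' ?_
  · refine (f.norm_coe_le_norm _).trans (le_mul_of_one_le_right (norm_nonneg _) ?_)
    linarith [sq_nonneg ‖u‖]
  · filter_upwards [hmem, hs0, hσ0] with i hi h1 h2
    have hm : Measurable fun u => f (standardize (ν i) u) :=
      f.continuous.measurable.comp measurable_standardize
    rw [integral_map (hTm i).aemeasurable hm.aestronglyMeasurable,
      integral_map measurable_standardize.aemeasurable f.continuous.aestronglyMeasurable]
    refine integral_congr_ae (ae_of_all _ fun z => ?_)
    exact congrArg f (standardize_map_smul_sub hi (posterior_absolutelyContinuous hac _ _ _)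
      (div_pos h1 h2) _ z)

end Limit

/-! ### The limit of vanishing noise -/

/-- A continuous function on `[0, 1]` vanishing only at `0` tends to `0` only at `0`. -/
lemma comap_nhds_zero_inf_principal_Ioc {σ : ℝ → ℝ} (hσ_cont : ContinuousOn σ (Icc 0 1))
    (hσ_zero : σ 0 = 0) (hσ_pos : ∀ t ∈ Ioc (0 : ℝ) 1, 0 < σ t) :
    comap σ (𝓝 0) ⊓ 𝓟 (Ioc 0 1) = 𝓝[>] (0 : ℝ) := by
  have hIoc : Ioc (0 : ℝ) 1 ∈ 𝓝[>] (0 : ℝ) := Ioc_mem_nhdsGT one_pos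
  refine le_antisymm ?_ (le_inf ?_ (le_principal_iff.2 hIoc))
  · refine (nhdsGT_basis (0 : ℝ)).ge_iff.2 fun δ hδ => ?_
    -- By compactness `σ` is bounded below on `[δ, 1]`, an empty interval if `δ > 1`.
    obtain ⟨c, hc, hmin⟩ : ∃ c > 0, ∀ t ∈ Icc δ 1, c ≤ σ t := by
      rcases (Icc δ 1).eq_empty_or_nonempty with he | hne
      · exact ⟨1, one_pos, by simp [he]⟩
      · obtain ⟨t, ht, htmin⟩ := isCompact_Icc.exists_isMinOn hne
          (hσ_cont.mono (Icc_subset_Icc_left hδ.le))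
        exact ⟨σ t, hσ_pos t ⟨hδ.trans_le ht.1, ht.2⟩, fun r hr => htmin hr⟩
    refine mem_inf_of_inter (preimage_mem_comap (Iio_mem_nhds hc)) (mem_principal_self _) ?_
    rintro t ⟨ht, ht0, ht1⟩
    refine ⟨ht0, lt_of_not_ge fun h => ?_⟩
    exact (hmin t ⟨h, ht1⟩).not_gt ht
  · rw [← tendsto_iff_comap]
    have h0 := (hσ_cont 0 ⟨le_rfl, zero_le_one⟩).tendsto
    rw [hσ_zero] at h0
    exact h0.mono_left (nhdsWithin_le_of_mem (mem_of_superset hIoc Ioc_subset_Icc_self))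

end Diffusion

theorem mainTheorem1 {d : ℕ} {Ω : Type*} [MeasurableSpace Ω]
    (P : Measure Ω) [IsProbabilityMeasure P]
    (s σ : ℝ → ℝ)
    (hs_cont : ContinuousOn s (Icc 0 1)) (hs_zero : s 0 = 1) (hs_pos : ∀ t ∈ Icc (0 : ℝ) 1, 0 < s t)
    (hσ_cont : ContinuousOn σ (Icc 0 1)) (hσ_zero : σ 0 = 0) (hσ_pos : ∀ t ∈ Ioc (0 : ℝ) 1, 0 < σ t)
    (x₀ : Ω → EuclideanSpace ℝ (Fin d))
    (ε : ℝ → Ω → EuclideanSpace ℝ (Fin d))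
    (X : ℝ → Ω → EuclideanSpace ℝ (Fin d))
    (hX : ∀ t w, X t w = s t • x₀ w + σ t • ε t w)
    (μ₀ : Measure (EuclideanSpace ℝ (Fin d))) [IsProbabilityMeasure μ₀]
    (hx₀ : HasLaw x₀ μ₀ P)
    (hε : ∀ t ∈ Ioc (0 : ℝ) 1, HasLaw (ε t) (stdGaussian (EuclideanSpace ℝ (Fin d))) P)
    (hindep : ∀ t ∈ Ioc (0 : ℝ) 1, IndepFun x₀ (ε t) P)
    (p : ℝ → EuclideanSpace ℝ (Fin d) → ℝ)
    (hp_nonneg : ∀ t ∈ Icc (0 : ℝ) 1, ∀ x, 0 ≤ p t x)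
    (hp_law : ∀ t ∈ Icc (0 : ℝ) 1,
      HasLaw (X t) (volume.withDensity fun x => ENNReal.ofReal (p t x)) P)
    (hp_smooth : ∀ t ∈ Icc (0 : ℝ) 1, ContDiff ℝ ∞ (p t))
    (hp_smooth_time : ∀ x, ContDiffOn ℝ ∞ (fun t => p t x) (Icc 0 1)) :
    -- `posterior` is the conditional law of `x₀` given `X t`
    (∀ t ∈ Ioc (0 : ℝ) 1, ∀ᵐ y ∂(P.map (X t)),
      condDistrib x₀ (X t) P y = Diffusion.posterior μ₀ (s t) (σ t) y) ∧
    -- its mean and covariance exist, and the covariance is invertible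
    (∀ t ∈ Ioc (0 : ℝ) 1, ∀ y, MemLp id 2 (Diffusion.posterior μ₀ (s t) (σ t) y) ∧
      (Diffusion.covMat (Diffusion.posterior μ₀ (s t) (σ t) y)).PosDef) ∧
    -- the limits `t → 0` and `σ t → 0` are the same
    comap σ (𝓝 0) ⊓ 𝓟 (Ioc 0 1) = 𝓝[>] (0 : ℝ) ∧
    -- convergence in distribution given `X t = y t`, whenever `y t → y₀` with `p 0 y₀ > 0`
    (∀ (y : ℝ → EuclideanSpace ℝ (Fin d)) (y₀ : EuclideanSpace ℝ (Fin d)),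
      Tendsto y (𝓝[>] 0) (𝓝 y₀) → 0 < p 0 y₀ →
      TendstoInDistribution
        (fun t => Diffusion.standardize (Diffusion.posterior μ₀ (s t) (σ t) (y t)))
        (𝓝[>] 0) id
        (fun t => Diffusion.posterior μ₀ (s t) (σ t) (y t))
        (stdGaussian (EuclideanSpace ℝ (Fin d)))) ∧
    -- in particular, almost surely along every sample path with `X t → x₀`
    (∀ᵐ w ∂P, Tendsto (fun t => X t w) (𝓝[>] 0) (𝓝 (x₀ w)) →
      TendstoInDistribution
        (fun t => Diffusion.standardize (Diffusion.posterior μ₀ (s t) (σ t) (X t w)))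
        (𝓝[>] 0) id
        (fun t => Diffusion.posterior μ₀ (s t) (σ t) (X t w))
        (stdGaussian (EuclideanSpace ℝ (Fin d)))) := by

  have hIoc : Ioc (0 : ℝ) 1 ∈ 𝓝[>] (0 : ℝ) := Ioc_mem_nhdsGT one_pos
  have hsub : Ioc (0 : ℝ) 1 ⊆ Icc 0 1 := Ioc_subset_Icc_self
  have h01 : (0 : ℝ) ∈ Icc (0 : ℝ) 1 := ⟨le_rfl, zero_le_one⟩
  have hle : 𝓝[>] (0 : ℝ) ≤ 𝓝[Icc 0 1] 0 := nhdsWithin_le_of_mem (mem_of_superset hIoc hsub)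
  have hμ₀ : μ₀ = volume.withDensity fun x => ENNReal.ofReal (p 0 x) := by
    rw [← hx₀.map_eq, ← (hp_law 0 h01).map_eq]
    congr 1
    funext w
    simp [hX, hs_zero, hσ_zero]
  have hpc : Continuous (p 0) := (hp_smooth 0 h01).continuous
  have hst : Tendsto s (𝓝[>] 0) (𝓝 1) := hs_zero ▸ (hs_cont 0 h01).tendsto.mono_left hle
  have hσt : Tendsto σ (𝓝[>] 0) (𝓝[>] 0) := by
    refine tendsto_nhdsWithin_iff.2 ⟨?_, mem_of_superset hIoc hσ_pos⟩
    have h0 := (hσ_cont 0 h01).tendsto.mono_left hle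
    rwa [hσ_zero] at h0
  have hlim : ∀ (y : ℝ → EuclideanSpace ℝ (Fin d)) (y₀ : EuclideanSpace ℝ (Fin d)),
      Tendsto y (𝓝[>] 0) (𝓝 y₀) → 0 < p 0 y₀ →
      TendstoInDistribution
        (fun t => Diffusion.standardize (Diffusion.posterior μ₀ (s t) (σ t) (y t)))
        (𝓝[>] 0) id
        (fun t => Diffusion.posterior μ₀ (s t) (σ t) (y t))
        (stdGaussian (EuclideanSpace ℝ (Fin d))) := fun y y₀ hy hpy =>
    Diffusion.tendstoInDistribution_standardize_posterior (hp_nonneg 0 h01) hpc.measurable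
      hpc.continuousAt hpy hμ₀ hst hσt hy
  refine ⟨fun t ht => ?_, fun t ht y => ?_,
    Diffusion.comap_nhds_zero_inf_principal_Ioc hσ_cont hσ_zero hσ_pos, hlim, ?_⟩
  · rw [show X t = fun w => s t • x₀ w + σ t • ε t w from funext (hX t)]
    exact Diffusion.condDistrib_ae_eq_posterior (hσ_pos t ht) hx₀ (hε t ht) (hindep t ht)
  · have hmem := Diffusion.memLp_two_posterior (μ₀ := μ₀) (hs_pos t (hsub ht)) (hσ_pos t ht) y
    refine ⟨hmem, Diffusion.posDef_covMat hmem (Diffusion.posterior_absolutelyContinuous ?_ _ _ _)⟩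
    exact hμ₀ ▸ withDensity_absolutelyContinuous _ _
  -- The law of `x₀` does not charge the zero set of its density.
  · have hpos : ∀ᵐ x ∂μ₀, 0 < p 0 x := by
      have hm : Measurable fun x => ENNReal.ofReal (p 0 x) := hpc.measurable.ennreal_ofReal
      rw [hμ₀, ae_withDensity_iff hm]
      exact ae_of_all _ fun x hx => by simpa using hx
    have hposw : ∀ᵐ w ∂P, 0 < p 0 (x₀ w) := by
      rw [← hx₀.map_eq] at hpos
      exact ae_of_ae_map hx₀.aemeasurable hpos
    filter_upwards [hposw] with w hw hXw
    exact hlim (fun t => X t w) (x₀ w) hXw hw
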